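/- Let $P_1,\dots,P_n$ ($n\ge 3$, $P_{n+1}=P_1$) be the vertices, in cyclic order, of a simple closed polygonal line in the Euclidean plane $\mathbb R^2$ (the half-open edges $[P_i,P_{i+1})$ are non-degenerate and pairwise disjoint), and let $\Pi\subset\mathbb R^2$ be the polygonal region it bounds, that is, the bounded domain (non-empty connected open set) whose boundary is $\bigcup_{i=1}^n P_iP_{i+1}$. For $X\in\mathbb R^2$ put $$\Sigma_\Pi(X)=\int_{P\in\Pi}|P-X|\,dP,\qquad \Sigma_{P_iP_{i+1}}(X)=\int_{P\in P_iP_{i+1}}|P-X|\,dP,$$ where the first integral is with respect to area and the second with respect to arc length along the segment $P_iP_{i+1}$. Then a point $m\in\mathbb R^2$ is a geometric median of $\Pi$, i.e. $\Sigma_\Pi(m)\le\Sigma_\Pi(X)$ for all $X\in\mathbb R^2$, if and only if $$\sum_{i=1}^n \frac{\Sigma_{P_iP_{i+1}}(m)}{|P_{i+1}-P_i|}\,\overrightarrow{P_iP_{i+1}}=0 .$$ -/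

import Mathlib

open MeasureTheory

noncomputable section

/-- The Euclidean plane. -/
abbrev Plane : Type := EuclideanSpace ℝ (Fin 2)

/-- The polygon with vertices `P_1, …, P_n` (indices cyclic, `P_{n+1} = P_1`) is simple: its closed
boundary path has no self-intersections, that is, the half-open edges `[P_i, P_{i+1})` are traversed
injectively and are pairwise disjoint. (This forces `n = 0` or `n ≥ 3`.) -/
def Polygon.IsSimple {n : ℕ} (poly : Polygon Plane n) : Prop :=
  ∀ i j : Fin n, ∀ s ∈ Set.Ico (0 : ℝ) 1, ∀ t ∈ Set.Ico (0 : ℝ) 1,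
    poly.edgePath ℝ i s = poly.edgePath ℝ j t → i = j ∧ s = t

/-- `Ω` is the polygonal region with (cyclically ordered) vertices `P_1, …, P_n`: the bounded plane
domain whose boundary is the simple closed polygonal line `P_1 P_2 … P_n P_1`. -/
structure IsPolygonalRegion {n : ℕ} (Ω : Set Plane) (poly : Polygon Plane n) : Prop where
  simple : poly.IsSimple
  isOpen : IsOpen Ω
  connected : IsConnected Ω
  bounded : Bornology.IsBounded Ω
  frontier_eq : frontier Ω = poly.boundary ℝ

/-- `Σ_Ω(X) = ∫_{P ∈ Ω} |P - X| dP`, with respect to area. -/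
def regionDistIntegral (Ω : Set Plane) (X : Plane) : ℝ :=
  ∫ P in Ω, dist P X

/-- `m` is a geometric median of `Ω`: it minimizes `Σ_Ω` over the whole plane. -/
def IsGeometricMedian (Ω : Set Plane) (m : Plane) : Prop :=
  ∀ X : Plane, regionDistIntegral Ω m ≤ regionDistIntegral Ω X

/-- `Σ_{AB}(X) = ∫_{P ∈ AB} |P - X| dP`, with respect to arc length on the segment `AB`
parametrized by `P(t) = A + t (B - A)`, `0 ≤ t ≤ 1`, with speed `|B - A|`. -/
def segmentDistIntegral (A B X : Plane) : ℝ :=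
  ∫ t in (0 : ℝ)..1, dist (AffineMap.lineMap A B t) X * dist A B

end

/-! `Σ_Ω` is convex, and differentiable with gradient obtained under the integral sign. Hence `m` is
a median iff the integral over `Ω` of the gradient of `dist · m` vanishes (`isGeometricMedian_iff`).
By the divergence theorem this integral equals, up to a quarter turn and a nonzero factor, the sum
over the edges of (mean distance to `m` along the edge) times (edge vector), which is the sum in the
theorem.

The divergence theorem is proved by slicing `Ω` with lines of direction `v`
(`setIntegral_distGrad`). `edgeJump` records how the indicator of `Ω` jumps across an edge. Along a
line that avoids the vertices, the indicator plus the step functions compensating these jumps is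
constant off the boundary, and it vanishes near minus infinity (`lineDefect_eq_zero`). So the
indicator is a combination of steps, and the fundamental theorem of calculus applies to each.

No Jordan curve theorem or notion of orientation is needed. Past all crossings the jumps, counted
with crossing signs, sum to zero. Letting the line sweep over a single vertex then shows that the
two edges meeting there have equal jumps (`edgeJump_finRotate`), so all jumps equal one constant,
which is nonzero because `Ω` is nonempty. -/

namespace PolygonMedian

open Filter Topology Set

variable {n : ℕ} {poly : Polygon Plane n} {v w p m : Plane} {Ω : Set Plane}

/-! ### Planar linear algebra and a connectedness criterion. -/

/-- The planar cross product. -/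
def cross (a b : Plane) : ℝ := a 0 * b 1 - a 1 * b 0

/-- Rotation by a right angle. -/
def perp (a : Plane) : Plane := !₂[-a 1, a 0]

lemma cross_add_right (a b c : Plane) : cross a (b + c) = cross a b + cross a c := by
  simp [cross]; ring

lemma cross_sub_right (a b c : Plane) : cross a (b - c) = cross a b - cross a c := by
  simp [cross]; ring

lemma cross_smul_right (a b : Plane) (r : ℝ) : cross a (r • b) = r * cross a b := by
  simp [cross]; ring

lemma cross_self (a : Plane) : cross a a = 0 := by
  simp [cross]; ring

lemma cross_swap (a b : Plane) : cross a b = -cross b a := by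
  simp [cross]; ring

lemma cross_zero_right (a : Plane) : cross a 0 = 0 := by simp [cross]

lemma cross_sum_right {ι : Type*} (s : Finset ι) (a : Plane) (f : ι → Plane) :
    cross a (∑ i ∈ s, f i) = ∑ i ∈ s, cross a (f i) := by
  classical
  induction s using Finset.induction_on with
  | empty => simp [cross_zero_right]
  | insert i s hi ih => rw [Finset.sum_insert hi, Finset.sum_insert hi, cross_add_right, ih]

lemma sq_add_sq_pos {a : Plane} (ha : a ≠ 0) : 0 < a 0 ^ 2 + a 1 ^ 2 := by
  by_contra! h
  apply ha
  have h0 : a 0 = 0 := by nlinarith [sq_nonneg (a 0), sq_nonneg (a 1)]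
  have h1 : a 1 = 0 := by nlinarith [sq_nonneg (a 0), sq_nonneg (a 1)]
  ext k
  fin_cases k <;> simp [h0, h1]

/-- A preconnected set missing the frontier of an open set is inside or outside of it. -/
lemma subset_or_disjoint_of_frontier {X : Type*} [TopologicalSpace X] {A Ω : Set X}
    (hA : IsPreconnected A) (hΩ : IsOpen Ω) (h : Disjoint A (frontier Ω)) :
    A ⊆ Ω ∨ Disjoint A Ω := by
  have hcov : A ⊆ Ω ∪ (closure Ω)ᶜ := by
    intro x hx
    by_cases hxΩ : x ∈ Ω
    · exact Or.inl hxΩ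
    · refine Or.inr fun hc => Set.disjoint_left.1 h hx ?_
      rw [hΩ.frontier_eq]
      exact ⟨hc, hxΩ⟩
  rcases hA.subset_or_subset hΩ isClosed_closure.isOpen_compl
    (disjoint_compl_right.mono_left subset_closure) hcov with h1 | h1
  · exact Or.inl h1
  · refine Or.inr (Set.disjoint_left.2 fun x hx hxΩ => h1 hx (subset_closure hxΩ))

/-! ### Edges of a simple polygon. -/

/-- The vector along the `i`-th edge. -/
def edgeVec (poly : Polygon Plane n) (i : Fin n) : Plane := poly (finRotate n i) - poly i

lemma edgePath_eq (poly : Polygon Plane n) (i : Fin n) (t : ℝ) :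
    poly.edgePath ℝ i t = poly i + t • edgeVec poly i := by
  simp [Polygon.edgePath, AffineMap.lineMap_apply, edgeVec, add_comm]

lemma edgePath_add (poly : Polygon Plane n) (i : Fin n) (t r : ℝ) :
    poly.edgePath ℝ i (t + r) = poly.edgePath ℝ i t + r • edgeVec poly i := by
  simp only [edgePath_eq]; module

lemma edgePath_zero (poly : Polygon Plane n) (i : Fin n) : poly.edgePath ℝ i 0 = poly i := by
  simp [edgePath_eq]

lemma edgePath_one (poly : Polygon Plane n) (i : Fin n) :
    poly.edgePath ℝ i 1 = poly (finRotate n i) := by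
  simp [edgePath_eq, edgeVec]

lemma continuous_edgePath (poly : Polygon Plane n) (i : Fin n) :
    Continuous (fun t : ℝ => poly.edgePath ℝ i t) := by
  simp only [edgePath_eq]; fun_prop

lemma isCompact_edgeSet (poly : Polygon Plane n) (i : Fin n) : IsCompact (poly.edgeSet ℝ i) := by
  rw [Polygon.edgeSet_eq_image_edgePath]
  exact isCompact_Icc.image (continuous_edgePath poly i)

lemma isCompact_boundary (poly : Polygon Plane n) : IsCompact (poly.boundary ℝ) :=
  isCompact_iUnion fun i => isCompact_edgeSet poly i

lemma mem_boundary_iff {poly : Polygon Plane n} {x : Plane} :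
    x ∈ poly.boundary ℝ ↔ ∃ i, ∃ t ∈ Icc (0 : ℝ) 1, poly.edgePath ℝ i t = x := by
  simp only [Polygon.boundary, mem_iUnion, Polygon.edgeSet_eq_image_edgePath, mem_image]

lemma edgeVec_ne_zero (hs : poly.IsSimple) (i : Fin n) : edgeVec poly i ≠ 0 := by
  intro h
  have := hs i i 0 (by simp) (1 / 2) (by norm_num) (by simp [edgePath_eq, h])
  norm_num at this

lemma vertex_injective (hs : poly.IsSimple) {i j : Fin n} (h : poly i = poly j) : i = j :=
  (hs i j 0 (by simp) 0 (by simp) (by simpa [edgePath_eq] using h)).1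

/-- Simplicity speaks of half-open edges only. A far endpoint `t = 1` is parameter `0` of the next
edge, which cannot match the positive parameter `s`. -/
lemma eq_of_edgePath_eq (hs : poly.IsSimple) {i j : Fin n} {s t : ℝ} (hsm : s ∈ Ioo (0 : ℝ) 1)
    (ht : t ∈ Icc (0 : ℝ) 1) (h : poly.edgePath ℝ i s = poly.edgePath ℝ j t) : i = j := by
  rcases eq_or_lt_of_le ht.2 with h1 | h1
  · subst h1
    rw [edgePath_one, ← edgePath_zero poly] at h
    have := hs i _ s ⟨hsm.1.le, hsm.2⟩ 0 (by simp) h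
    exact absurd this.2 hsm.1.ne'
  · exact (hs i j s ⟨hsm.1.le, hsm.2⟩ t ⟨ht.1, h1⟩ h).1

/-! ### The side of an edge on which the region lies. -/

/-- Whether the region lies, near the midpoint of the `i`-th edge, on the side that
`σ • perp (edgeVec poly i)` points to. -/
def SideIn (Ω : Set Plane) (poly : Polygon Plane n) (i : Fin n) (σ : ℝ) : Prop :=
  ∀ᶠ r in 𝓝[>] (0 : ℝ), poly.edgePath ℝ i (1 / 2) + r • σ • perp (edgeVec poly i) ∈ Ω

/-- A compact part of an open edge has positive distance from the other edges. -/
lemma exists_pos_le_dist_other_edges (hs : poly.IsSimple) (i : Fin n) {t0 t1 : ℝ} (ht0 : 0 < t0)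
    (ht1 : t1 < 1) :
    ∃ δ > 0, ∀ j ≠ i, ∀ s ∈ Icc (0 : ℝ) 1, ∀ t ∈ Icc t0 t1,
      δ ≤ dist (poly.edgePath ℝ j s) (poly.edgePath ℝ i t) := by
  have hcl : IsClosed (⋃ j : {j : Fin n // j ≠ i}, poly.edgeSet ℝ j.1) :=
    isClosed_iUnion_of_finite fun j => (isCompact_edgeSet poly j.1).isClosed
  have hK : IsCompact ((fun t : ℝ => poly.edgePath ℝ i t) '' Icc t0 t1) :=
    isCompact_Icc.image (continuous_edgePath poly i)
  have hsub : (fun t : ℝ => poly.edgePath ℝ i t) '' Icc t0 t1 ⊆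
      (⋃ j : {j : Fin n // j ≠ i}, poly.edgeSet ℝ j.1)ᶜ := by
    rintro _ ⟨t, ht, rfl⟩ hmem
    obtain ⟨⟨j, hj⟩, hmem⟩ := mem_iUnion.1 hmem
    rw [Polygon.edgeSet_eq_image_edgePath] at hmem
    obtain ⟨s, hsI, hEq⟩ := hmem
    have h01 : t ∈ Ioo (0 : ℝ) 1 := ⟨ht0.trans_le ht.1, ht.2.trans_lt ht1⟩
    exact hj (eq_of_edgePath_eq hs h01 hsI hEq.symm).symm
  obtain ⟨δ, hδ, h⟩ := hK.exists_thickening_subset_open hcl.isOpen_compl hsub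
  refine ⟨δ, hδ, fun j hj s hsI t ht => ?_⟩
  by_contra! hlt
  refine h (Metric.mem_thickening_iff.2 ⟨_, mem_image_of_mem _ ht, hlt⟩) ?_
  refine mem_iUnion.2 ⟨⟨j, hj⟩, ?_⟩
  rw [Polygon.edgeSet_eq_image_edgePath]
  exact mem_image_of_mem _ hsI

/-- A thin parallelogram on one side of the edge links the midpoint to the point with parameter `t`.
Being connected and free of boundary points, it lies inside or outside the region as a whole, so the
side can be tested at either point. -/
lemma exists_box (hs : poly.IsSimple) (i : Fin n) {σ t : ℝ} (ht : t ∈ Ioo (0 : ℝ) 1) {u : Plane}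
    (hu : 0 < σ * cross (edgeVec poly i) u) :
    ∃ A : Set Plane, IsPreconnected A ∧ Disjoint A (poly.boundary ℝ) ∧
      (∀ᶠ r in 𝓝[>] (0 : ℝ), poly.edgePath ℝ i (1 / 2) + r • σ • perp (edgeVec poly i) ∈ A) ∧
      ∀ᶠ r in 𝓝[>] (0 : ℝ), poly.edgePath ℝ i t + r • u ∈ A := by
  set d := edgeVec poly i with hd
  have hd0 : d ≠ 0 := edgeVec_ne_zero hs i
  have hdd := sq_add_sq_pos hd0
  have hσ : σ ≠ 0 := by rintro rfl; simp at hu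
  set t0 := min t (1 / 2) / 2
  set t1 := (max t (1 / 2) + 1) / 2
  have hmin : 0 < min t (1 / 2 : ℝ) := lt_min ht.1 (by norm_num)
  have hmax : max t (1 / 2 : ℝ) < 1 := max_lt ht.2 (by norm_num)
  have ht0 : 0 < t0 := by positivity
  have ht1 : t1 < 1 := by simp only [t1]; linarith
  have htm : t ∈ Ioo t0 t1 := by
    constructor
    · simp only [t0]; linarith [min_le_left t (1 / 2 : ℝ), ht.1]
    · simp only [t1]; linarith [le_max_left t (1 / 2 : ℝ), ht.2]
  have hhm : (1 / 2 : ℝ) ∈ Ioo t0 t1 := by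
    constructor
    · simp only [t0]; linarith [min_le_right t (1 / 2 : ℝ)]
    · simp only [t1]; linarith [le_max_right t (1 / 2 : ℝ)]
  obtain ⟨δ, hδ, hK⟩ := exists_pos_le_dist_other_edges hs i ht0 ht1
  set N := σ • perp d with hN
  -- Heights below `δ'` displace by less than `δ`, too little to reach another edge.
  set δ' := δ / (‖N‖ + 1)
  have hδ' : 0 < δ' := by positivity
  let f : ℝ × ℝ → Plane := fun q => poly.edgePath ℝ i q.1 + q.2 • N
  have hf : Continuous f :=
    ((continuous_edgePath poly i).comp continuous_fst).add (continuous_snd.smul continuous_const)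
  refine ⟨f '' (Ioo t0 t1 ×ˢ Ioo 0 δ'),
    (isPreconnected_Ioo.prod isPreconnected_Ioo).image f hf.continuousOn, ?_, ?_, ?_⟩
  · rw [Set.disjoint_left]
    rintro _ ⟨⟨t', r⟩, ⟨ht', hr⟩, rfl⟩ hmem
    obtain ⟨j, s, hsI, hEq⟩ := mem_boundary_iff.1 hmem
    simp only [f] at hEq ht' hr
    by_cases hj : j = i
    · subst hj
      have h2 := congrArg (fun x => cross d (x - poly j)) hEq
      simp only [edgePath_eq, ← hd, add_sub_cancel_left, cross_smul_right, cross_self, mul_zero,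
        cross_add_right, hN, add_assoc, zero_add] at h2
      have h3 : cross d (perp d) = d 0 ^ 2 + d 1 ^ 2 := by simp [cross, perp]; ring
      rw [h3] at h2
      have := mul_ne_zero hr.1.ne' (mul_ne_zero hσ hdd.ne')
      exact this h2.symm
    · have h1 := hK j hj s hsI t' (Ioo_subset_Icc_self ht')
      rw [hEq, dist_self_add_left, norm_smul, Real.norm_of_nonneg hr.1.le] at h1
      have h2 : r * (‖N‖ + 1) < δ := (lt_div_iff₀ (by positivity)).1 hr.2
      linarith [hr.1]
  · filter_upwards [Ioo_mem_nhdsGT hδ'] with r hr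
    exact ⟨(1 / 2, r), ⟨hhm, hr⟩, rfl⟩
  -- Coordinates of `u` in the orthogonal basis `d`, `N`; the sign condition on `u` is exactly `0 <
  -- β`.
  · set α := (u 0 * d 0 + u 1 * d 1) / (d 0 ^ 2 + d 1 ^ 2)
    set β := cross d u / (σ * (d 0 ^ 2 + d 1 ^ 2))
    have hβ : 0 < β := by
      have : β = (σ * cross d u) / (σ ^ 2 * (d 0 ^ 2 + d 1 ^ 2)) := by
        simp only [β]; field_simp
      rw [this]; positivity
    have hdec : u = α • d + β • N := by
      ext k
      fin_cases k <;> simp [hN, perp, α, β, cross] <;> field_simp <;> ring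
    have e1 : ∀ᶠ r in 𝓝[>] (0 : ℝ), t + r * α ∈ Ioo t0 t1 := by
      have : Tendsto (fun r : ℝ => t + r * α) (𝓝[>] 0) (𝓝 t) := by
        have : Continuous fun r : ℝ => t + r * α := by fun_prop
        simpa using (this.tendsto 0).mono_left nhdsWithin_le_nhds
      exact this (Ioo_mem_nhds htm.1 htm.2)
    filter_upwards [e1, Ioo_mem_nhdsGT (div_pos hδ' hβ)] with r hr1 hr2
    refine ⟨(t + r * α, r * β), ⟨hr1, mul_pos hr2.1 hβ, (lt_div_iff₀ hβ).1 hr2.2⟩, ?_⟩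
    simp only [f]
    rw [edgePath_add, ← hd]
    conv_rhs => rw [hdec]
    module

/-- The region lies on the same side of an edge at all of its interior points. -/
lemma sideIn_iff {Ω : Set Plane} (hs : poly.IsSimple) (hΩ : IsOpen Ω)
    (hfr : frontier Ω = poly.boundary ℝ) (i : Fin n) {σ t : ℝ} (ht : t ∈ Ioo (0 : ℝ) 1) {u : Plane}
    (hu : 0 < σ * cross (edgeVec poly i) u) :
    ∀ᶠ r in 𝓝[>] (0 : ℝ), (poly.edgePath ℝ i t + r • u ∈ Ω ↔ SideIn Ω poly i σ) := by
  obtain ⟨A, hA, hd, h1, h2⟩ := exists_box hs i ht hu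
  rcases subset_or_disjoint_of_frontier hA hΩ (hfr ▸ hd) with h | h
  · have : SideIn Ω poly i σ := h1.mono fun r hr => h hr
    exact h2.mono fun r hr => by simp [this, h hr]
  · have : ¬ SideIn Ω poly i σ := fun hS => by
      obtain ⟨r, hr1, hr2⟩ := (hS.and h1).exists
      exact Set.disjoint_left.1 h hr2 hr1
    exact h2.mono fun r hr => by simp [this, Set.disjoint_left.1 h hr]

/-! ### Crossings of the edges with a line that avoids the vertices. -/

noncomputable section

open Classical in
/-- The jump of the indicator function of the region across the `i`-th edge: its value on the left
of the edge minus its value on the right. -/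
def edgeJump (Ω : Set Plane) (poly : Polygon Plane n) (i : Fin n) : ℝ :=
  (if SideIn Ω poly i 1 then 1 else 0) - (if SideIn Ω poly i (-1) then 1 else 0)

/-- The signed number of crossings of the `i`-th edge with the line `cross v · = c`. -/
def crossing (poly : Polygon Plane n) (v : Plane) (c : ℝ) (i : Fin n) : ℝ :=
  (if cross v (poly i) < c then 1 else 0) - (if cross v (poly (finRotate n i)) < c then 1 else 0)

/-- The parameter on the `i`-th edge where it meets the line `cross v · = c`. -/
def edgeParam (poly : Polygon Plane n) (v : Plane) (c : ℝ) (i : Fin n) : ℝ :=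
  (c - cross v (poly i)) / cross v (edgeVec poly i)

/-- The point where the `i`-th edge meets the line `cross v · = c`. -/
def crossPt (poly : Polygon Plane n) (v : Plane) (c : ℝ) (i : Fin n) : Plane :=
  poly.edgePath ℝ i (edgeParam poly v c i)

/-- The parameter of the projection of `x` to the line through `p` with direction `v`. -/
def linePos (v p x : Plane) : ℝ :=
  ((x 0 - p 0) * v 0 + (x 1 - p 1) * v 1) / (v 0 ^ 2 + v 1 ^ 2)

end

lemma linePos_add_smul (hv : v ≠ 0) (s : ℝ) : linePos v p (p + s • v) = s := by
  have := sq_add_sq_pos hv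
  simp [linePos]
  field_simp

lemma add_linePos_smul (hv : v ≠ 0) {x : Plane} (h : cross v x = cross v p) :
    p + linePos v p x • v = x := by
  have := sq_add_sq_pos hv
  simp only [cross] at h
  ext k
  fin_cases k
  · simp [linePos]; field_simp; linear_combination (v 1) * h
  · simp [linePos]; field_simp; linear_combination (-v 0) * h

lemma cross_edgeVec (v : Plane) (i : Fin n) :
    cross v (edgeVec poly i) = cross v (poly (finRotate n i)) - cross v (poly i) :=
  cross_sub_right _ _ _

lemma cross_edgePath (v : Plane) (i : Fin n) (t : ℝ) :
    cross v (poly.edgePath ℝ i t) = cross v (poly i) + t * cross v (edgeVec poly i) := by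
  rw [edgePath_eq, cross_add_right, cross_smul_right]

lemma crossing_cases {c : ℝ} (hc : ∀ i, cross v (poly i) ≠ c) (i : Fin n)
    (h : crossing poly v c i ≠ 0) :
    (crossing poly v c i = 1 ∧ cross v (poly i) < c ∧ c < cross v (poly (finRotate n i))) ∨
    (crossing poly v c i = -1 ∧ cross v (poly (finRotate n i)) < c ∧ c < cross v (poly i)) := by
  have h1 := hc i
  have h2 := hc (finRotate n i)
  unfold crossing at h ⊢
  by_cases a : cross v (poly i) < c <;> by_cases b : cross v (poly (finRotate n i)) < c
  · rw [if_pos a, if_pos b, sub_self] at h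
    exact absurd rfl h
  · left; simp only [a, b, if_true, if_false]
    exact ⟨by norm_num, trivial, lt_of_le_of_ne (not_lt.1 b) h2.symm⟩
  · right; simp only [a, b, if_true, if_false]
    exact ⟨by norm_num, trivial, lt_of_le_of_ne (not_lt.1 a) h1.symm⟩
  · rw [if_neg a, if_neg b, sub_self] at h
    exact absurd rfl h

lemma crossing_mul_pos {c : ℝ} (hc : ∀ i, cross v (poly i) ≠ c) (i : Fin n)
    (h : crossing poly v c i ≠ 0) : 0 < crossing poly v c i * cross v (edgeVec poly i) := by
  rw [cross_edgeVec]
  rcases crossing_cases hc i h with ⟨h1, h2, h3⟩ | ⟨h1, h2, h3⟩ <;> rw [h1] <;> linarith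

lemma edgeParam_mem {c : ℝ} (hc : ∀ i, cross v (poly i) ≠ c) (i : Fin n)
    (h : crossing poly v c i ≠ 0) : edgeParam poly v c i ∈ Ioo (0 : ℝ) 1 := by
  unfold edgeParam
  rw [cross_edgeVec]
  rcases crossing_cases hc i h with ⟨h1, h2, h3⟩ | ⟨h1, h2, h3⟩
  · exact ⟨div_pos (by linarith) (by linarith), (div_lt_one (by linarith)).2 (by linarith)⟩
  · exact ⟨div_pos_of_neg_of_neg (by linarith) (by linarith),
      (div_lt_one_of_neg (by linarith)).2 (by linarith)⟩

lemma cross_crossPt {c : ℝ} (hc : ∀ i, cross v (poly i) ≠ c) (i : Fin n)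
    (h : crossing poly v c i ≠ 0) : cross v (crossPt poly v c i) = c := by
  have h0 : cross v (edgeVec poly i) ≠ 0 := right_ne_zero_of_mul (crossing_mul_pos hc i h).ne'
  rw [crossPt, cross_edgePath, edgeParam, div_mul_cancel₀ _ h0]
  ring

lemma crossPt_mem_boundary {c : ℝ} (hc : ∀ i, cross v (poly i) ≠ c) (i : Fin n)
    (h : crossing poly v c i ≠ 0) : crossPt poly v c i ∈ poly.boundary ℝ :=
  mem_boundary_iff.2 ⟨i, _, Ioo_subset_Icc_self (edgeParam_mem hc i h), rfl⟩

lemma crossing_ne_zero_of_mem {c : ℝ} (hc : ∀ i, cross v (poly i) ≠ c) {i : Fin n} {t : ℝ}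
    (ht : t ∈ Icc (0 : ℝ) 1) (h : cross v (poly.edgePath ℝ i t) = c) :
    crossing poly v c i ≠ 0 ∧ t = edgeParam poly v c i := by
  have h1 := hc i
  have h2 := hc (finRotate n i)
  rw [cross_edgePath, cross_edgeVec] at h
  have hne : cross v (poly (finRotate n i)) - cross v (poly i) ≠ 0 := by
    intro h0; rw [h0] at h; simp at h; exact h1 h
  refine ⟨?_, ?_⟩
  · unfold crossing
    rcases lt_or_gt_of_ne hne with h0 | h0
    · have a : cross v (poly (finRotate n i)) < c := lt_of_le_of_ne (by nlinarith [ht.2]) h2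
      have b : ¬ cross v (poly i) < c := by nlinarith [ht.1]
      rw [if_pos a, if_neg b]; norm_num
    · have a : cross v (poly i) < c := lt_of_le_of_ne (by nlinarith [ht.1]) h1
      have b : ¬ cross v (poly (finRotate n i)) < c := by nlinarith [ht.2]
      rw [if_pos a, if_neg b]; norm_num
  · rw [edgeParam, cross_edgeVec, eq_div_iff hne]
    linarith

lemma cross_line (v p : Plane) (s : ℝ) : cross v (p + s • v) = cross v p := by
  rw [cross_add_right, cross_smul_right, cross_self, mul_zero, add_zero]

lemma crossPt_injOn (hs : poly.IsSimple) {c : ℝ} (hc : ∀ i, cross v (poly i) ≠ c) {i j : Fin n}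
    (hi : crossing poly v c i ≠ 0) (hj : crossing poly v c j ≠ 0)
    (h : crossPt poly v c i = crossPt poly v c j) : i = j :=
  eq_of_edgePath_eq hs (edgeParam_mem hc i hi) (Ioo_subset_Icc_self (edgeParam_mem hc j hj)) h

lemma add_linePos_crossPt (hv : v ≠ 0) {c : ℝ} (hc : ∀ i, cross v (poly i) ≠ c)
    (hp : cross v p = c) {i : Fin n} (hi : crossing poly v c i ≠ 0) :
    p + linePos v p (crossPt poly v c i) • v = crossPt poly v c i :=
  add_linePos_smul hv ((cross_crossPt hc i hi).trans hp.symm)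

/-- On a line avoiding the vertices, the only boundary points are the crossing points. -/
lemma exists_crossing_of_mem_boundary (hv : v ≠ 0) {c : ℝ} (hc : ∀ i, cross v (poly i) ≠ c)
    (hp : cross v p = c) {s : ℝ} (h : p + s • v ∈ poly.boundary ℝ) :
    ∃ i, crossing poly v c i ≠ 0 ∧ crossPt poly v c i = p + s • v ∧
      linePos v p (crossPt poly v c i) = s := by
  obtain ⟨i, t, ht, hEq⟩ := mem_boundary_iff.1 h
  have h1 : cross v (poly.edgePath ℝ i t) = c := by rw [hEq, cross_line, hp]
  obtain ⟨h2, h3⟩ := crossing_ne_zero_of_mem hc ht h1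
  have h4 : crossPt poly v c i = p + s • v := by rw [crossPt, ← h3, hEq]
  exact ⟨i, h2, h4, by rw [h4, linePos_add_smul hv]⟩

/-- When the crossing is `+1` the edge passes to the left of `v`, so moving along `v` leads from the
left of the edge to its right; hence the minus sign here and its absence in `sideIn_before`. -/
lemma sideIn_after (hs : poly.IsSimple) (hΩ : IsOpen Ω) (hfr : frontier Ω = poly.boundary ℝ)
    {c : ℝ} (hc : ∀ i, cross v (poly i) ≠ c) {i : Fin n} (hi : crossing poly v c i ≠ 0) {s₀ : ℝ}
    (h : crossPt poly v c i = p + s₀ • v) :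
    ∀ᶠ s in 𝓝[>] s₀, (p + s • v ∈ Ω ↔ SideIn Ω poly i (-crossing poly v c i)) := by
  have hu : 0 < -crossing poly v c i * cross (edgeVec poly i) v := by
    rw [cross_swap (edgeVec poly i) v, neg_mul_neg]
    exact crossing_mul_pos hc i hi
  have ht : Tendsto (fun s => s - s₀) (𝓝[>] s₀) (𝓝[>] 0) := by
    refine tendsto_nhdsWithin_iff.2 ⟨?_, ?_⟩
    · have : Continuous fun s : ℝ => s - s₀ := by fun_prop
      simpa using (this.tendsto s₀).mono_left nhdsWithin_le_nhds
    · filter_upwards [self_mem_nhdsWithin] with s hs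
      exact sub_pos.2 (mem_Ioi.1 hs)
  filter_upwards [ht.eventually (sideIn_iff hs hΩ hfr i (edgeParam_mem hc i hi) hu)] with s hs
  rw [← hs]
  change _ ↔ crossPt poly v c i + _ ∈ Ω
  rw [h, add_assoc, ← add_smul, add_sub_cancel]

lemma sideIn_before (hs : poly.IsSimple) (hΩ : IsOpen Ω) (hfr : frontier Ω = poly.boundary ℝ)
    {c : ℝ} (hc : ∀ i, cross v (poly i) ≠ c) {i : Fin n} (hi : crossing poly v c i ≠ 0) {s₀ : ℝ}
    (h : crossPt poly v c i = p + s₀ • v) :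
    ∀ᶠ s in 𝓝[<] s₀, (p + s • v ∈ Ω ↔ SideIn Ω poly i (crossing poly v c i)) := by
  have hu : 0 < crossing poly v c i * cross (edgeVec poly i) (-v) := by
    rw [← neg_one_smul ℝ v, cross_smul_right, cross_swap (edgeVec poly i) v, neg_one_mul, neg_neg]
    exact crossing_mul_pos hc i hi
  have ht : Tendsto (fun s => s₀ - s) (𝓝[<] s₀) (𝓝[>] 0) := by
    refine tendsto_nhdsWithin_iff.2 ⟨?_, ?_⟩
    · have : Continuous fun s : ℝ => s₀ - s := by fun_prop
      simpa using (this.tendsto s₀).mono_left nhdsWithin_le_nhds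
    · filter_upwards [self_mem_nhdsWithin] with s hs
      exact sub_pos.2 (mem_Iio.1 hs)
  filter_upwards [ht.eventually (sideIn_iff hs hΩ hfr i (edgeParam_mem hc i hi) hu)] with s hs
  rw [← hs]
  change _ ↔ crossPt poly v c i + _ ∈ Ω
  rw [h]
  have : p + s₀ • v + (s₀ - s) • -v = p + s • v := by module
  rw [this]

/-! ### The indicator along a line as a sum of steps. -/

/-- A function on the line that is constant on punctured neighbourhoods of every point is, up to
isolated points, constant. -/
lemma exists_const_of_punctured {g : ℝ → ℝ} (h : ∀ x, ∃ a, ∀ᶠ y in 𝓝[≠] x, g y = a) :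
    ∃ a, ∀ x, ∀ᶠ y in 𝓝[≠] x, g y = a := by
  choose a ha using h
  have hloc : IsLocallyConstant a := by
    rw [IsLocallyConstant.iff_eventually_eq]
    intro x
    have h1 := eventually_nhdsWithin_iff.1 (ha x)
    filter_upwards [h1.eventually_nhds] with y hy
    by_cases hxy : y = x
    · rw [hxy]
    have h2 : ∀ᶠ z in 𝓝[≠] y, g z = a x := by
      have h3 : ∀ᶠ z in 𝓝[≠] y, z ≠ x := (isOpen_ne.eventually_mem hxy).filter_mono nhdsWithin_le_nhds
      filter_upwards [hy.filter_mono nhdsWithin_le_nhds, h3] with z hz1 hz2 using hz1 hz2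
    -- Punctured neighbourhoods in `ℝ` are nonempty, so two values taken on the same one must agree.
    obtain ⟨z, hz1, hz2⟩ := ((ha y).and h2).exists
    rw [← hz1, ← hz2]
  exact ⟨a 0, fun x => by rw [← hloc.apply_eq_of_preconnectedSpace x 0]; exact ha x⟩

lemma eventually_step_eq {a x : ℝ} (h : a ≠ x) :
    ∀ᶠ y in 𝓝 x, (if a < y then (1 : ℝ) else 0) = if a < x then 1 else 0 := by
  rcases lt_or_gt_of_ne h with h | h
  · filter_upwards [lt_mem_nhds h] with y hy
    rw [if_pos hy, if_pos h]
  · filter_upwards [gt_mem_nhds h] with y hy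
    rw [if_neg (not_lt.2 (mem_Iio.1 hy).le), if_neg (not_lt.2 h.le)]

open Classical in
/-- The indicator function of the region along the line `p + ℝ v`, plus the sum of the steps that
should cancel its jumps. -/
noncomputable def lineDefect (Ω : Set Plane) (poly : Polygon Plane n) (v p : Plane) (s : ℝ) : ℝ :=
  (if p + s • v ∈ Ω then 1 else 0) + ∑ i, edgeJump Ω poly i * crossing poly v (cross v p) i *
    (if linePos v p (crossPt poly v (cross v p) i) < s then 1 else 0)

lemma continuous_line (v p : Plane) : Continuous (fun s : ℝ => p + s • v) := by fun_prop

/-- For an edge that is not crossed, `crossPt` carries no meaning, but its step has coefficient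
zero; the position matters only for crossed edges. -/
lemma eventually_step_term_eq {i : Fin n} {s₀ c : ℝ}
    (h : crossing poly v c i ≠ 0 → linePos v p (crossPt poly v c i) ≠ s₀) :
    ∀ᶠ s in 𝓝 s₀, edgeJump Ω poly i * crossing poly v c i *
        (if linePos v p (crossPt poly v c i) < s then (1 : ℝ) else 0) =
      edgeJump Ω poly i * crossing poly v c i *
        (if linePos v p (crossPt poly v c i) < s₀ then (1 : ℝ) else 0) := by
  by_cases h0 : crossing poly v c i = 0
  · simp [h0]
  · filter_upwards [eventually_step_eq (h h0)] with s hs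
    rw [hs]

lemma lineDefect_eventually_eq (hΩ : IsOpen Ω) (hfr : frontier Ω = poly.boundary ℝ) (hv : v ≠ 0)
    (hc : ∀ i, cross v (poly i) ≠ cross v p) {s₀ : ℝ} (h : p + s₀ • v ∉ poly.boundary ℝ) :
    ∀ᶠ s in 𝓝 s₀, lineDefect Ω poly v p s = lineDefect Ω poly v p s₀ := by
  have h1 : ∀ᶠ s in 𝓝 s₀, (p + s • v ∈ Ω ↔ p + s₀ • v ∈ Ω) := by
    by_cases hm : p + s₀ • v ∈ Ω
    · filter_upwards [(continuous_line v p).continuousAt.eventually (hΩ.mem_nhds hm)] with s hs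
      exact iff_of_true hs hm
    · have hcl : p + s₀ • v ∈ (closure Ω)ᶜ := fun hcl => h (by
        rw [← hfr, hΩ.frontier_eq]; exact ⟨hcl, hm⟩)
      filter_upwards [(continuous_line v p).continuousAt.eventually
        (isClosed_closure.isOpen_compl.mem_nhds hcl)] with s hs
      exact iff_of_false (fun hin => hs (subset_closure hin)) hm
  have h2 : ∀ᶠ s in 𝓝 s₀, ∀ i, edgeJump Ω poly i * crossing poly v (cross v p) i *
        (if linePos v p (crossPt poly v (cross v p) i) < s then (1 : ℝ) else 0) =
      edgeJump Ω poly i * crossing poly v (cross v p) i *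
        (if linePos v p (crossPt poly v (cross v p) i) < s₀ then (1 : ℝ) else 0) := by
    refine eventually_all.2 fun i => eventually_step_term_eq fun hi hEq => h ?_
    rw [← hEq, add_linePos_crossPt hv hc rfl hi]
    exact crossPt_mem_boundary hc i hi
  filter_upwards [h1, h2] with s hs1 hs2
  rw [lineDefect, lineDefect, Finset.sum_congr rfl fun i _ => hs2 i]
  by_cases hm : p + s₀ • v ∈ Ω <;> simp [hm, hs1]

/-- At a boundary point exactly one edge is crossed, and its step compensates the jump of the
indicator there; all other steps are locally constant. -/
lemma lineDefect_punctured (hs : poly.IsSimple) (hΩ : IsOpen Ω) (hfr : frontier Ω = poly.boundary ℝ)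
    (hv : v ≠ 0) (hc : ∀ i, cross v (poly i) ≠ cross v p) (s₀ : ℝ) :
    ∃ a, ∀ᶠ s in 𝓝[≠] s₀, lineDefect Ω poly v p s = a := by
  classical
  by_cases h : p + s₀ • v ∈ poly.boundary ℝ
  swap
  · exact ⟨_, (lineDefect_eventually_eq hΩ hfr hv hc h).filter_mono nhdsWithin_le_nhds⟩
  obtain ⟨i, hi, hpt, hpos⟩ := exists_crossing_of_mem_boundary hv hc rfl h
  set c := cross v p with hcdef
  have h2 : ∀ᶠ s in 𝓝 s₀, ∀ j ∈ Finset.univ.erase i, edgeJump Ω poly j * crossing poly v c j *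
        (if linePos v p (crossPt poly v c j) < s then (1 : ℝ) else 0) =
      edgeJump Ω poly j * crossing poly v c j *
        (if linePos v p (crossPt poly v c j) < s₀ then (1 : ℝ) else 0) := by
    refine (Finset.eventually_all _).2 fun j hj => eventually_step_term_eq fun hj0 hEq => ?_
    refine Finset.ne_of_mem_erase hj (crossPt_injOn hs hc hj0 hi ?_)
    rw [hpt, ← hEq, add_linePos_crossPt hv hc rfl hj0]
  refine ⟨(if SideIn Ω poly i (crossing poly v c i) then 1 else 0) +
    ∑ j ∈ Finset.univ.erase i, edgeJump Ω poly j * crossing poly v c j *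
        (if linePos v p (crossPt poly v c j) < s₀ then (1 : ℝ) else 0), ?_⟩
  rw [← nhdsLT_sup_nhdsGT, eventually_sup]
  constructor
  · filter_upwards [sideIn_before hs hΩ hfr hc hi hpt, h2.filter_mono nhdsWithin_le_nhds,
      self_mem_nhdsWithin] with s hs1 hs2 hs3
    rw [lineDefect, ← Finset.add_sum_erase _ _ (Finset.mem_univ i), Finset.sum_congr rfl hs2,
      ← hcdef, hpos]
    simp [hs1, not_lt.2 (mem_Iio.1 hs3).le]
  · filter_upwards [sideIn_after hs hΩ hfr hc hi hpt, h2.filter_mono nhdsWithin_le_nhds,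
      self_mem_nhdsWithin] with s hs1 hs2 hs3
    rw [lineDefect, ← Finset.add_sum_erase _ _ (Finset.mem_univ i), Finset.sum_congr rfl hs2,
      ← hcdef, hpos]
    simp only [hs1, mem_Ioi.1 hs3, if_true, ← add_assoc, mul_one, edgeJump]
    congr 1
    rcases crossing_cases hc i hi with ⟨h1, -⟩ | ⟨h1, -⟩ <;> rw [h1] <;> simp

lemma eventually_line_notMem (hv : v ≠ 0) {K : Set Plane} (hK : Bornology.IsBounded K) :
    ∀ᶠ s : ℝ in cocompact ℝ, p + s • v ∉ K := by
  have h1 : Tendsto (fun s : ℝ => p + s • v) (cocompact ℝ) (Bornology.cobounded Plane) := by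
    have h2 : Tendsto (fun s : ℝ => s • v) (cocompact ℝ) (Bornology.cobounded Plane) := by
      rw [← tendsto_norm_atTop_iff_cobounded]
      simp only [norm_smul]
      exact (tendsto_norm_cocompact_atTop (E := ℝ)).atTop_mul_const (norm_pos_iff.2 hv)
    exact (tendsto_const_add_cobounded p).comp h2
  exact h1.eventually (Bornology.isBounded_def.1 hK)

/-- The common punctured value is read off near minus infinity, where the line has left the region
and no step has started. -/
lemma lineDefect_eq_zero (hs : poly.IsSimple) (hΩ : IsOpen Ω) (hb : Bornology.IsBounded Ω)
    (hfr : frontier Ω = poly.boundary ℝ) (hv : v ≠ 0)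
    (hc : ∀ i, cross v (poly i) ≠ cross v p) {s : ℝ} (h : p + s • v ∉ poly.boundary ℝ) :
    lineDefect Ω poly v p s = 0 := by
  obtain ⟨a, ha⟩ := exists_const_of_punctured (lineDefect_punctured hs hΩ hfr hv hc)
  have key : ∀ s, p + s • v ∉ poly.boundary ℝ → lineDefect Ω poly v p s = a := fun s h => by
    obtain ⟨z, h1, h2⟩ := ((ha s).and ((lineDefect_eventually_eq hΩ hfr hv hc h).filter_mono
      nhdsWithin_le_nhds)).exists
    rw [← h2, h1]
  have hbot : ∀ᶠ s : ℝ in atBot, p + s • v ∉ Ω ∧ p + s • v ∉ poly.boundary ℝ ∧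
      ∀ i, ¬ linePos v p (crossPt poly v (cross v p) i) < s := by
    refine Eventually.and ?_ (Eventually.and ?_ (eventually_all.2 fun i => ?_))
    · exact (eventually_line_notMem hv hb).filter_mono atBot_le_cocompact
    · exact (eventually_line_notMem hv (isCompact_boundary poly).isBounded).filter_mono
        atBot_le_cocompact
    · filter_upwards [eventually_le_atBot (linePos v p (crossPt poly v (cross v p) i))] with s hs
      exact not_lt.2 hs
  obtain ⟨z, h1, h2, h3⟩ := hbot.exists
  rw [key s h, ← key z h2]
  simp [lineDefect, h1, h3]

/-- Near plus infinity every step has started and the indicator is zero again. -/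
lemma sum_edgeJump_crossing (hs : poly.IsSimple) (hΩ : IsOpen Ω) (hb : Bornology.IsBounded Ω)
    (hfr : frontier Ω = poly.boundary ℝ) (hv : v ≠ 0)
    (hc : ∀ i, cross v (poly i) ≠ cross v p) :
    ∑ i, edgeJump Ω poly i * crossing poly v (cross v p) i = 0 := by
  have htop : ∀ᶠ s : ℝ in atTop, p + s • v ∉ Ω ∧ p + s • v ∉ poly.boundary ℝ ∧
      ∀ i, linePos v p (crossPt poly v (cross v p) i) < s := by
    refine Eventually.and ?_ (Eventually.and ?_ (eventually_all.2 fun i => eventually_gt_atTop _))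
    · exact (eventually_line_notMem hv hb).filter_mono atTop_le_cocompact
    · exact (eventually_line_notMem hv (isCompact_boundary poly).isBounded).filter_mono
        atTop_le_cocompact
  obtain ⟨z, h1, h2, h3⟩ := htop.exists
  have := lineDefect_eq_zero hs hΩ hb hfr hv hc h2
  simpa [lineDefect, h1, h3] using this

/-! ### All edges have the same nonzero jump. -/

/-- A direction separating finitely many distinct points. -/
lemma exists_separating_slope {ι : Type*} [Finite ι] {f : ι → Plane} (hf : Function.Injective f) :
    ∃ k : ℝ, ∀ i j, i ≠ j → cross !₂[1, k] (f i) ≠ cross !₂[1, k] (f j) := by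
  have hfin : (Set.range fun q : ι × ι => (f q.1 1 - f q.2 1) / (f q.1 0 - f q.2 0)).Finite :=
    Set.finite_range _
  obtain ⟨k, hk⟩ := hfin.exists_notMem
  refine ⟨k, fun i j hij h => ?_⟩
  simp only [cross, Matrix.cons_val_zero, Matrix.cons_val_one, one_mul] at h
  have h' : f i 1 - f j 1 = k * (f i 0 - f j 0) := by linarith
  by_cases h0 : f i 0 - f j 0 = 0
  · rw [h0, mul_zero] at h'
    apply hij
    apply hf
    ext l
    fin_cases l
    · exact sub_eq_zero.1 h0
    · exact sub_eq_zero.1 h'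
  · exact hk ⟨(i, j), by simp only [h']; field_simp⟩

/-- Summation by parts turns the vanishing jump sum into a sum over the vertices below the level
`c`, weighted by differences of consecutive jumps. With `v` separating the vertices, moving `c` past
one of them changes a single term, whose weight is therefore zero. -/
lemma edgeJump_finRotate (hs : poly.IsSimple) (hΩ : IsOpen Ω) (hb : Bornology.IsBounded Ω)
    (hfr : frontier Ω = poly.boundary ℝ) (i₀ : Fin n) :
    edgeJump Ω poly (finRotate n i₀) = edgeJump Ω poly i₀ := by
  obtain ⟨k, hk⟩ := exists_separating_slope (f := fun i => poly i) (fun i j => vertex_injective hs)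
  set v : Plane := !₂[1, k] with hvdef
  have hv : v ≠ 0 := fun h => by
    have := congrArg (fun x : Plane => x 0) h
    simp [hvdef] at this
  set D : Fin n → ℝ := fun i => edgeJump Ω poly i - edgeJump Ω poly ((finRotate n).symm i) with hD
  have hsum : ∀ c, (∀ i, cross v (poly i) ≠ c) →
      ∑ i, D i * (if cross v (poly i) < c then (1 : ℝ) else 0) = 0 := by
    intro c hc
    have hp : cross v !₂[0, c] = c := by simp [cross, hvdef]
    have h1 := sum_edgeJump_crossing (p := !₂[0, c]) hs hΩ hb hfr hv (by simpa only [hp] using hc)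
    rw [hp] at h1
    simp only [crossing, mul_sub, Finset.sum_sub_distrib] at h1
    have h2 : ∑ i, edgeJump Ω poly i * (if cross v (poly (finRotate n i)) < c then (1 : ℝ) else 0) =
        ∑ i, edgeJump Ω poly ((finRotate n).symm i) *
          (if cross v (poly i) < c then (1 : ℝ) else 0) := by
      rw [← Equiv.sum_comp (finRotate n) fun i => edgeJump Ω poly ((finRotate n).symm i) *
          (if cross v (poly i) < c then (1 : ℝ) else 0)]
      simp only [Equiv.symm_apply_apply]
    rw [h2] at h1
    simpa only [hD, sub_mul, Finset.sum_sub_distrib] using h1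
  set j := finRotate n i₀ with hj
  have hstep : ∀ᶠ c in 𝓝 (cross v (poly j)), ∀ i ∈ Finset.univ.erase j,
      D i * (if cross v (poly i) < c then (1 : ℝ) else 0) =
        D i * (if cross v (poly i) < cross v (poly j) then (1 : ℝ) else 0) ∧ cross v (poly i) ≠ c := by
    refine (Finset.eventually_all _).2 fun i hi => ?_
    have hne := hk i j (Finset.ne_of_mem_erase hi)
    filter_upwards [eventually_step_eq hne, isOpen_ne.eventually_mem hne.symm] with c h1 h2
    exact ⟨by rw [h1], Ne.symm h2⟩
  have hgen : ∀ c, (∀ i ∈ Finset.univ.erase j, D i * (if cross v (poly i) < c then (1 : ℝ) else 0) =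
        D i * (if cross v (poly i) < cross v (poly j) then (1 : ℝ) else 0) ∧
        cross v (poly i) ≠ c) → cross v (poly j) ≠ c →
      D j * (if cross v (poly j) < c then (1 : ℝ) else 0) + ∑ i ∈ Finset.univ.erase j,
        D i * (if cross v (poly i) < cross v (poly j) then (1 : ℝ) else 0) = 0 := by
    intro c h1 h2
    have h3 : ∀ i, cross v (poly i) ≠ c := fun i => by
      by_cases hij : i = j
      · rwa [hij]
      · exact (h1 i (Finset.mem_erase.2 ⟨hij, Finset.mem_univ i⟩)).2
    have h4 := hsum c h3
    rwa [← Finset.add_sum_erase _ _ (Finset.mem_univ j),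
      Finset.sum_congr rfl fun i hi => (h1 i hi).1] at h4
  -- Levels just above and just below the vertex `j`, with no other vertex in between.
  obtain ⟨c₁, h1, h1'⟩ := ((hstep.filter_mono nhdsWithin_le_nhds).and
    (self_mem_nhdsWithin (s := Ioi (cross v (poly j))))).exists
  obtain ⟨c₂, h2, h2'⟩ := ((hstep.filter_mono nhdsWithin_le_nhds).and
    (self_mem_nhdsWithin (s := Iio (cross v (poly j))))).exists
  have e1 := hgen c₁ h1 (ne_of_lt h1')
  have e2 := hgen c₂ h2 (ne_of_gt h2')
  rw [if_pos (mem_Ioi.1 h1')] at e1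
  rw [if_neg (not_lt.2 (mem_Iio.1 h2').le)] at e2
  have : D j = 0 := by linarith
  simpa only [hD, hj, Equiv.symm_apply_apply, sub_eq_zero] using this

lemma eq_of_finRotate_invariant {α : Type*} {f : Fin n → α} (h : ∀ i, f (finRotate n i) = f i)
    (i j : Fin n) : f i = f j := by
  cases n with
  | zero => exact i.elim0
  | succ n =>
    have h0 : ∀ i, f i = f 0 := fun i => by
      induction i using Fin.induction with
      | zero => rfl
      | succ i ih => rw [← ih, ← h i.castSucc, finRotate_apply, Fin.coeSucc_eq_succ]
    rw [h0 i, h0 j]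

/-- Were all jumps zero, `lineDefect` would be the bare indicator, hence zero off the boundary. A
horizontal line through a point of `Ω`, raised slightly to miss the vertices, contradicts this. -/
lemma exists_edgeJump_ne_zero (hs : poly.IsSimple) (hΩ : IsOpen Ω) (hne : Ω.Nonempty)
    (hb : Bornology.IsBounded Ω) (hfr : frontier Ω = poly.boundary ℝ) :
    ∃ i, edgeJump Ω poly i ≠ 0 := by
  by_contra! h
  obtain ⟨q, hq⟩ := hne
  have h1 : ∀ᶠ r in 𝓝[>] (0 : ℝ), q + r • (!₂[0, 1] : Plane) ∈ Ω := by
    refine ((continuous_line (!₂[0, 1] : Plane) q).continuousAt.eventually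
      (hΩ.mem_nhds ?_)).filter_mono nhdsWithin_le_nhds
    simpa using hq
  have h2 : ∀ᶠ r in 𝓝[>] (0 : ℝ), ∀ i, r ≠ cross !₂[1, 0] (poly i) - cross !₂[1, 0] q := by
    refine eventually_all.2 fun i => ?_
    by_cases h0 : cross !₂[1, 0] (poly i) - cross !₂[1, 0] q = 0
    · filter_upwards [self_mem_nhdsWithin] with r hr
      rw [h0]; exact ne_of_gt hr
    · exact (isOpen_ne.eventually_mem (Ne.symm h0)).filter_mono nhdsWithin_le_nhds
  obtain ⟨r, hr1, hr2⟩ := (h1.and h2).exists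
  have hv : (!₂[1, 0] : Plane) ≠ 0 := fun h => by
    have := congrArg (fun x : Plane => x 0) h
    simp at this
  have := lineDefect_eq_zero (p := q + r • (!₂[0, 1] : Plane)) (s := 0) hs hΩ hb hfr hv
    (fun i hi => hr2 i (by
      rw [hi, cross_add_right, cross_smul_right]
      simp [cross]))
    (fun hmem => by
      rw [← hfr, hΩ.frontier_eq, zero_smul, add_zero] at hmem
      exact hmem.2 hr1)
  simp [lineDefect, hr1, h] at this

/-- All edges have the region on the same side. -/
lemma exists_edgeJump_eq (hs : poly.IsSimple) (hΩ : IsOpen Ω) (hne : Ω.Nonempty)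
    (hb : Bornology.IsBounded Ω) (hfr : frontier Ω = poly.boundary ℝ) :
    ∃ ε : ℝ, ε ≠ 0 ∧ ∀ i, edgeJump Ω poly i = ε := by
  obtain ⟨i, hi⟩ := exists_edgeJump_ne_zero hs hΩ hne hb hfr
  exact ⟨_, hi, fun j => eq_of_finRotate_invariant (edgeJump_finRotate hs hΩ hb hfr) j i⟩

/-! ### Integration along lines and over their levels. -/

/-- The fundamental theorem of calculus on the intersection of the region with a line. -/
lemma integral_line_indicator (hs : poly.IsSimple) (hΩ : IsOpen Ω) (hb : Bornology.IsBounded Ω)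
    (hfr : frontier Ω = poly.boundary ℝ) (hv : v ≠ 0)
    (hc : ∀ i, cross v (poly i) ≠ cross v p) {φ ψ : Plane → ℝ}
    (hd : ∀ s : ℝ, HasDerivAt (fun s : ℝ => φ (p + s • v)) (ψ (p + s • v)) s)
    (hψ : Continuous fun s : ℝ => ψ (p + s • v)) :
    ∫ s : ℝ, Ω.indicator ψ (p + s • v) = ∑ i, edgeJump Ω poly i *
      (crossing poly v (cross v p) i * φ (crossPt poly v (cross v p) i)) := by
  set c := cross v p with hcdef
  set S : Fin n → ℝ := fun i => linePos v p (crossPt poly v c i) with hS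
  have htop : ∀ᶠ s : ℝ in atTop, (∀ s' ≥ s, p + s' • v ∉ Ω) ∧ ∀ i, S i < s := by
    refine Eventually.and ?_ (eventually_all.2 fun i => eventually_gt_atTop _)
    exact eventually_forall_ge_atTop.2
      ((eventually_line_notMem hv hb).filter_mono atTop_le_cocompact)
  -- Cutting at `R`, beyond the region and all crossings, makes each step integrable; the boundary
  -- terms at `R` cancel by `sum_edgeJump_crossing`.
  obtain ⟨R, hR, hSR⟩ := htop.exists
  have hae : ∀ᵐ s : ℝ, p + s • v ∉ poly.boundary ℝ := by
    have hfin : {s : ℝ | ¬ p + s • v ∉ poly.boundary ℝ}.Finite := by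
      refine (Set.finite_range S).subset fun s hs => ?_
      obtain ⟨i, -, -, hi⟩ := exists_crossing_of_mem_boundary hv hc rfl (not_not.1 hs)
      exact ⟨i, hi⟩
    exact hfin.measure_zero volume
  have hEq : (fun s : ℝ => Ω.indicator ψ (p + s • v)) =ᵐ[volume] fun s =>
      -∑ i, edgeJump Ω poly i * crossing poly v c i *
        (Ioc (S i) R).indicator (fun s => ψ (p + s • v)) s := by
    filter_upwards [hae] with s hs'
    have h0 := lineDefect_eq_zero hs hΩ hb hfr hv hc hs'
    rcases le_or_gt s R with hsR | hsR
    · have h1 : Ω.indicator ψ (p + s • v) =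
          (∑ i, edgeJump Ω poly i * crossing poly v c i * (if S i < s then 1 else 0)) *
            -ψ (p + s • v) := by
        rw [lineDefect, ← eq_neg_iff_add_eq_zero] at h0
        rw [mul_neg, ← neg_mul, ← h0]
        by_cases hm : p + s • v ∈ Ω <;> simp [hm]
      rw [h1, mul_neg, Finset.sum_mul]
      congr 1
      refine Finset.sum_congr rfl fun i _ => ?_
      by_cases hi : S i < s <;> simp [hi, hsR, Set.indicator]
    · rw [Set.indicator_of_notMem (hR s hsR.le)]
      simp [Set.indicator, not_le.2 hsR]
  have hint : ∀ i, Integrable ((Ioc (S i) R).indicator fun s : ℝ => ψ (p + s • v)) := fun i =>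
    (integrable_indicator_iff measurableSet_Ioc).2
      ((hψ.integrableOn_Icc (a := S i) (b := R)).mono_set Ioc_subset_Icc_self)
  rw [integral_congr_ae hEq, integral_neg, integral_finsetSum _ fun i _ => (hint i).const_mul _]
  have hi : ∀ i, ∫ s, edgeJump Ω poly i * crossing poly v c i *
      (Ioc (S i) R).indicator (fun s => ψ (p + s • v)) s =
      edgeJump Ω poly i * crossing poly v c i * φ (p + R • v) -
        edgeJump Ω poly i * (crossing poly v c i * φ (crossPt poly v c i)) := by
    intro i
    rw [integral_const_mul, integral_indicator measurableSet_Ioc,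
      ← intervalIntegral.integral_of_le (hSR i).le,
      intervalIntegral.integral_eq_sub_of_hasDerivAt (fun s _ => hd s) (hψ.intervalIntegrable _ _)]
    by_cases h0 : crossing poly v c i = 0
    · simp [h0]
    · rw [add_linePos_crossPt hv hc rfl h0]; ring
  rw [Finset.sum_congr rfl fun i _ => hi i, Finset.sum_sub_distrib, ← Finset.sum_mul,
    sum_edgeJump_crossing hs hΩ hb hfr hv hc]
  ring

lemma edgeParam_add_mul (i : Fin n) {a : ℝ} (h : cross v (edgeVec poly i) = a) (ha : a ≠ 0) (t : ℝ) :
    edgeParam poly v (cross v (poly i) + a * t) i = t := by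
  rw [edgeParam, h]; field_simp; ring

lemma crossing_mul_eq_indicator (i : Fin n) (k : ℝ → ℝ) (c : ℝ) :
    crossing poly v c i * k c =
      (Ioc (cross v (poly i)) (cross v (poly (finRotate n i)))).indicator k c -
      (Ioc (cross v (poly (finRotate n i))) (cross v (poly i))).indicator k c := by
  unfold crossing Set.indicator
  simp only [mem_Ioc, ← not_lt]
  by_cases a : cross v (poly i) < c <;> by_cases b : cross v (poly (finRotate n i)) < c <;>
    simp only [a, b] <;> simp

lemma continuous_crossPt (i : Fin n) : Continuous fun c => crossPt poly v c i := by
  unfold crossPt edgeParam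
  exact (continuous_edgePath poly i).comp (by fun_prop)

lemma integrable_crossing_mul {φ : Plane → ℝ} (hφ : Continuous φ) (i : Fin n) :
    Integrable fun c => crossing poly v c i * φ (crossPt poly v c i) := by
  simp only [crossing_mul_eq_indicator i fun c => φ (crossPt poly v c i)]
  have hk : Continuous fun c => φ (crossPt poly v c i) := hφ.comp (continuous_crossPt i)
  have h : ∀ a b : ℝ, Integrable ((Ioc a b).indicator fun c => φ (crossPt poly v c i)) := fun a b =>
    (integrable_indicator_iff measurableSet_Ioc).2
      ((hk.integrableOn_Icc (a := a) (b := b)).mono_set Ioc_subset_Icc_self)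
  exact (h _ _).sub (h _ _)

/-- Substitution of the edge parameter for the level `c`. The crossing sign is the orientation of
the interval of levels, so no absolute value appears; an edge parallel to `v` contributes zero. -/
lemma integral_crossing_mul {φ : Plane → ℝ} (hφ : Continuous φ) (i : Fin n) :
    ∫ c, crossing poly v c i * φ (crossPt poly v c i) =
      cross v (edgeVec poly i) * ∫ t in (0 : ℝ)..1, φ (poly.edgePath ℝ i t) := by
  simp only [crossing_mul_eq_indicator i fun c => φ (crossPt poly v c i)]
  have hk : Continuous fun c => φ (crossPt poly v c i) := hφ.comp (continuous_crossPt i)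
  have h : ∀ a b : ℝ, Integrable ((Ioc a b).indicator fun c => φ (crossPt poly v c i)) := fun a b =>
    (integrable_indicator_iff measurableSet_Ioc).2
      ((hk.integrableOn_Icc (a := a) (b := b)).mono_set Ioc_subset_Icc_self)
  rw [integral_sub (h _ _) (h _ _), integral_indicator measurableSet_Ioc,
    integral_indicator measurableSet_Ioc]
  change (∫ c in cross v (poly i)..cross v (poly (finRotate n i)), φ (crossPt poly v c i)) = _
  have hd := cross_edgeVec (poly := poly) v i
  by_cases h0 : cross v (edgeVec poly i) = 0
  · rw [h0] at hd
    rw [h0, sub_eq_zero.1 hd.symm]; simp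
  · have h1 := intervalIntegral.smul_integral_comp_add_mul (a := 0) (b := 1)
      (fun c => φ (crossPt poly v c i)) (cross v (edgeVec poly i)) (cross v (poly i))
    rw [mul_zero, mul_one, add_zero, hd, add_sub_cancel, ← hd] at h1
    rw [← h1, smul_eq_mul]
    simp only [crossPt, edgeParam_add_mul i rfl h0]

/-! ### The gradient of the distance and the divergence theorem. -/

lemma hasFDerivAt_norm_of_ne_zero {E : Type*} [NormedAddCommGroup E] [InnerProductSpace ℝ E] {y : E}
    (hy : y ≠ 0) : HasFDerivAt (fun x : E => ‖x‖) (‖y‖⁻¹ • innerSL ℝ y) y := by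
  have h := (hasStrictFDerivAt_norm_sq y).hasFDerivAt.sqrt
    (pow_ne_zero 2 (norm_ne_zero_iff.2 hy))
  simp only [Real.sqrt_sq (norm_nonneg _)] at h
  convert h using 1
  ext z
  have := norm_ne_zero_iff.2 hy
  simp
  field_simp

/-- The gradient of the distance to `m`. -/
noncomputable def distGrad (m x : Plane) : Plane →L[ℝ] ℝ := ‖x - m‖⁻¹ • innerSL ℝ (x - m)

lemma distGrad_apply (m x v : Plane) : distGrad m x v = ‖x - m‖⁻¹ * inner ℝ (x - m) v := by
  rw [distGrad, smul_apply, innerSL_apply_apply, smul_eq_mul]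

lemma distGrad_swap (m x : Plane) : distGrad m x = -distGrad x m := by
  simp only [distGrad, norm_sub_rev x m]
  rw [← neg_sub m x, map_neg, smul_neg]

lemma hasFDerivAt_dist {x : Plane} (h : x ≠ m) :
    HasFDerivAt (fun x => dist x m) (distGrad m x) x := by
  have h1 := (hasFDerivAt_norm_of_ne_zero (sub_ne_zero.2 h)).comp x ((hasFDerivAt_id x).sub_const m)
  simpa [dist_eq_norm, Function.comp_def, distGrad] using h1

lemma norm_distGrad_le (m x : Plane) : ‖distGrad m x‖ ≤ 1 := by
  rw [distGrad, norm_smul, innerSL_apply_norm, norm_inv, norm_norm]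
  by_cases h : ‖x - m‖ = 0
  · simp [h]
  · rw [inv_mul_cancel₀ h]

lemma stronglyMeasurable_distGrad (m : Plane) : StronglyMeasurable (distGrad m) := by
  have h1 : Measurable fun x : Plane => ‖x - m‖⁻¹ := by fun_prop
  have h2 : Continuous fun x : Plane => innerSL ℝ (x - m) := by fun_prop
  exact h1.stronglyMeasurable.smul h2.stronglyMeasurable

lemma integrableOn_distGrad (hb : Bornology.IsBounded Ω) (m : Plane) :
    IntegrableOn (distGrad m) Ω :=
  Measure.integrableOn_of_bounded (M := 1) hb.measure_lt_top.ne
    (stronglyMeasurable_distGrad m).aestronglyMeasurable (ae_of_all _ fun x => norm_distGrad_le m x)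

lemma continuousAt_distGrad {x : Plane} (h : x ≠ m) : ContinuousAt (distGrad m) x := by
  have h1 : ContinuousAt (fun x : Plane => ‖x - m‖⁻¹) x :=
    ContinuousAt.inv₀ (by fun_prop) (norm_ne_zero_iff.2 (sub_ne_zero.2 h))
  have h2 : Continuous fun x : Plane => innerSL ℝ (x - m) := by fun_prop
  exact h1.smul h2.continuousAt

/-- The divergence theorem on the polygonal region for the constant direction `v` and the function
`dist · m`. -/
lemma setIntegral_distGrad (hs : poly.IsSimple) (hΩ : IsOpen Ω) (hb : Bornology.IsBounded Ω)
    (hfr : frontier Ω = poly.boundary ℝ) (hvw : cross v w = 1)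
    (hmp : MeasurePreserving fun q : ℝ × ℝ => q.1 • v + q.2 • w) :
    ∫ x in Ω, distGrad m x v = ∑ i, edgeJump Ω poly i *
      (cross v (edgeVec poly i) * ∫ t in (0 : ℝ)..1, dist (poly.edgePath ℝ i t) m) := by
  have hv : v ≠ 0 := by rintro rfl; simp [cross] at hvw
  have hint : Integrable (Ω.indicator fun x => distGrad m x v) :=
    (integrable_indicator_iff hΩ.measurableSet).2
      ((integrableOn_distGrad hb m).apply_continuousLinearMap v)
  have hcont : Continuous fun x : Plane => dist x m := by fun_prop
  rw [← integral_indicator hΩ.measurableSet, ← hmp.map_eq,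
    integral_map hmp.aemeasurable (hmp.map_eq.symm ▸ hint.aestronglyMeasurable),
    Measure.volume_eq_prod,
    integral_prod_symm (fun q : ℝ × ℝ => Ω.indicator (fun x => distGrad m x v) (q.1 • v + q.2 • w))
      (hmp.integrable_comp_of_integrable hint)]
  -- Almost every line misses the vertices and also `m`, where the distance is not differentiable.
  have hae : ∀ᵐ c : ℝ, (∀ i, cross v (poly i) ≠ c) ∧ cross v m ≠ c := by
    have h : ∀ a : ℝ, ∀ᵐ c : ℝ, a ≠ c := fun a =>
      mem_of_superset (compl_mem_ae_iff.2 (measure_singleton a)) fun c hc => Ne.symm hc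
    exact (ae_all_iff.2 fun i => h _).and (h _)
  have hline : ∀ᵐ c : ℝ, ∫ s : ℝ, Ω.indicator (fun x => distGrad m x v) (s • v + c • w) =
      ∑ i, edgeJump Ω poly i * (crossing poly v c i * dist (crossPt poly v c i) m) := by
    filter_upwards [hae] with c hc
    have hp : cross v (c • w) = c := by rw [cross_smul_right, hvw, mul_one]
    have hne : ∀ s : ℝ, c • w + s • v ≠ m := fun s h => hc.2 (by rw [← h, cross_line, hp])
    have h := integral_line_indicator (p := c • w) (φ := fun x => dist x m)
      (ψ := fun x => distGrad m x v) hs hΩ hb hfr hv (by simpa only [hp] using hc.1)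
      (fun s => by
        have h1 : HasDerivAt (fun s : ℝ => c • w + s • v) v s := by
          simpa using ((hasDerivAt_id s).smul_const v).const_add (c • w)
        exact (hasFDerivAt_dist (hne s)).comp_hasDerivAt s h1)
      (continuous_iff_continuousAt.2 fun s =>
        (ContinuousAt.comp (f := fun s : ℝ => c • w + s • v) (continuousAt_distGrad (hne s))
          (continuous_line v (c • w)).continuousAt).clm_apply continuousAt_const)
    rw [hp] at h
    simpa only [add_comm] using h
  rw [integral_congr_ae hline, integral_finsetSum _ fun i _ =>
    (integrable_crossing_mul hcont i).const_mul _]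
  simp only [integral_const_mul, integral_crossing_mul hcont]

lemma measurePreserving_coords :
    MeasurePreserving fun q : ℝ × ℝ => q.1 • (!₂[1, 0] : Plane) + q.2 • (!₂[0, 1] : Plane) := by
  have h := (PiLp.volume_preserving_toLp (Fin 2)).comp (volume_preserving_finTwoArrow ℝ).symm
  have hEq : (fun q : ℝ × ℝ => q.1 • (!₂[1, 0] : Plane) + q.2 • (!₂[0, 1] : Plane)) =
      WithLp.toLp 2 ∘ MeasurableEquiv.finTwoArrow.symm := by
    ext q k
    fin_cases k <;> simp
  rw [hEq]
  exact h

/-- The second direction `(0, 1)` needs a partner with cross product `1`, hence `(-1, 0)`. -/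
lemma measurePreserving_coords_rotated :
    MeasurePreserving fun q : ℝ × ℝ => q.1 • (!₂[0, 1] : Plane) + q.2 • (!₂[-1, 0] : Plane) := by
  have h1 : MeasurePreserving (Prod.map (fun x : ℝ => -x) (id : ℝ → ℝ)) :=
    (Measure.measurePreserving_neg volume).prod (MeasurePreserving.id volume)
  have h2 : MeasurePreserving (Prod.swap : ℝ × ℝ → ℝ × ℝ) := Measure.measurePreserving_swap
  convert measurePreserving_coords.comp (h1.comp h2) using 1
  ext q k
  fin_cases k <;> simp

/-! ### Medians as zeros of the integrated gradient. -/

/-- The subgradient inequality for the convex function `dist x ·` at `m`, from Cauchy–Schwarz. It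
persists at `m = x`, where the inverse norm makes the gradient zero. -/
lemma dist_add_distGrad_le (m x y : Plane) : dist x m + distGrad x m (y - m) ≤ dist x y := by
  rw [distGrad_apply, dist_comm x m, dist_comm x y, dist_eq_norm, dist_eq_norm]
  by_cases h : ‖m - x‖ = 0
  · simp [h]
  have hpos : 0 < ‖m - x‖ := lt_of_le_of_ne (norm_nonneg _) (Ne.symm h)
  have h1 := real_inner_le_norm (m - x) (y - x)
  have h2 : inner ℝ (m - x) (y - x) = ‖m - x‖ ^ 2 + inner ℝ (m - x) (y - m) := by
    rw [← real_inner_self_eq_norm_sq, ← inner_add_right]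
    congr 1; abel
  rw [h2] at h1
  refine le_of_mul_le_mul_left ?_ hpos
  rw [mul_add, mul_inv_cancel_left₀ h]
  linarith

lemma integrableOn_dist (hb : Bornology.IsBounded Ω) (m : Plane) :
    IntegrableOn (fun x => dist x m) Ω :=
  (Continuous.continuousOn (by fun_prop)).integrableOn_compact hb.isCompact_closure
    |>.mono_set subset_closure

/-- A minimum is a critical point, the integrand being 1-Lipschitz in `X` and differentiable at `m`
for almost every `P`. Conversely, integrating the subgradient inequality makes a critical point a
global minimum. -/
lemma isGeometricMedian_iff (hb : Bornology.IsBounded Ω) :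
    IsGeometricMedian Ω m ↔ ∫ x in Ω, distGrad m x = 0 := by
  have hneg : ∫ x in Ω, distGrad m x = -∫ x in Ω, distGrad x m := by
    rw [← integral_neg]; simp only [distGrad_swap m]
  have hI : IntegrableOn (fun x => distGrad x m) Ω := by
    have := (integrableOn_distGrad hb m).neg
    refine this.congr (ae_of_all _ fun x => ?_)
    simp [distGrad_swap m x]
  have : IsFiniteMeasure (volume.restrict Ω) := ⟨by simpa using hb.measure_lt_top⟩
  rw [hneg, neg_eq_zero]
  constructor
  · intro h
    have hder : HasFDerivAt (regionDistIntegral Ω) (∫ x in Ω, distGrad x m) m := by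
      refine (hasFDerivAt_integral_of_dominated_loc_of_lip (μ := volume.restrict Ω)
        (F := fun X P => dist P X) (bound := fun _ => 1) univ_mem ?_ (integrableOn_dist hb m)
        hI.aestronglyMeasurable ?_ (integrable_const 1) ?_).2
      · exact Eventually.of_forall fun X =>
          (Continuous.aestronglyMeasurable (by fun_prop))
      · refine ae_of_all _ fun P => ?_
        simp only [map_one]
        exact (LipschitzWith.dist_right P).lipschitzOnWith
      · have h0 : ∀ᵐ P ∂(volume.restrict Ω), P ≠ m :=
          ae_restrict_of_ae (compl_mem_ae_iff.2 (measure_singleton m))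
        filter_upwards [h0] with P hP
        simpa only [dist_comm P] using hasFDerivAt_dist (m := P) (Ne.symm hP)
    exact IsLocalMin.hasFDerivAt_eq_zero (Eventually.of_forall h) hder
  · intro h X
    have h1 : ∫ x in Ω, (dist x m + distGrad x m (X - m)) ≤ ∫ x in Ω, dist x X :=
      integral_mono ((integrableOn_dist hb m).add (hI.apply_continuousLinearMap _))
        (integrableOn_dist hb X) fun x => dist_add_distGrad_le m x X
    rw [integral_add (integrableOn_dist hb m) (hI.apply_continuousLinearMap _),
      ← ContinuousLinearMap.integral_apply hI, h] at h1
    simpa [regionDistIntegral] using h1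

lemma segmentDistIntegral_div (hs : poly.IsSimple) (m : Plane) (i : Fin n) :
    segmentDistIntegral (poly i) (poly (finRotate n i)) m /
      dist (poly (finRotate n i)) (poly i) = ∫ t in (0 : ℝ)..1, dist (poly.edgePath ℝ i t) m := by
  have h : dist (poly (finRotate n i)) (poly i) ≠ 0 := by
    rw [dist_eq_norm]; exact norm_ne_zero_iff.2 (edgeVec_ne_zero hs i)
  rw [segmentDistIntegral, intervalIntegral.integral_mul_const, dist_comm (poly i),
    mul_div_cancel_right₀ _ h]
  rfl

end PolygonMedian

/-! ### The theorem. -/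

open PolygonMedian

theorem proposition3 {n : ℕ} (poly : Polygon Plane n) (Ω : Set Plane)
    (hΩ : IsPolygonalRegion Ω poly) (m : Plane) :
    IsGeometricMedian Ω m ↔
      ∑ i : Fin n,
        (segmentDistIntegral (poly i) (poly (finRotate n i)) m /
            dist (poly (finRotate n i)) (poly i)) •
          (poly (finRotate n i) - poly i) = 0 := by
  obtain ⟨hs, ho, hcon, hb, hfr⟩ := hΩ
  obtain ⟨ε, hε, hj⟩ := exists_edgeJump_eq hs ho hcon.nonempty hb hfr
  simp only [segmentDistIntegral_div hs]
  set V := ∑ i : Fin n, (∫ t in (0 : ℝ)..1, dist (poly.edgePath ℝ i t) m) •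
    (poly (finRotate n i) - poly i) with hV
  have key : ∀ v w : Plane, cross v w = 1 →
      (MeasurePreserving fun q : ℝ × ℝ => q.1 • v + q.2 • w) →
      (∫ x in Ω, distGrad m x) v = ε * cross v V := fun v w hvw hmp => by
    rw [ContinuousLinearMap.integral_apply (integrableOn_distGrad hb m),
      setIntegral_distGrad hs ho hb hfr hvw hmp, hV, cross_sum_right, Finset.mul_sum]
    refine Finset.sum_congr rfl fun i _ => ?_
    rw [hj, cross_smul_right, edgeVec, mul_comm (cross _ _)]
  -- Two directions suffice: they determine the gradient functional and yield both coordinates of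
  -- `V`.
  have k0 := key !₂[1, 0] !₂[0, 1] (by simp [cross]) measurePreserving_coords
  have k1 := key !₂[0, 1] !₂[-1, 0] (by simp [cross]) measurePreserving_coords_rotated
  have c0 : cross !₂[1, 0] V = V 1 := by simp [cross]
  have c1 : cross !₂[0, 1] V = -V 0 := by simp [cross]
  rw [c0] at k0
  rw [c1] at k1
  rw [isGeometricMedian_iff hb]
  constructor
  · intro h
    rw [h, zero_apply, eq_comm, mul_eq_zero, or_iff_right hε] at k0 k1
    ext k
    fin_cases k
    · exact neg_eq_zero.1 k1
    · exact k0
  · intro h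
    rw [h] at k0 k1
    ext x
    have hx : x = x 0 • (!₂[1, 0] : Plane) + x 1 • (!₂[0, 1] : Plane) := by
      ext k; fin_cases k <;> simp
    rw [hx, map_add, map_smul, map_smul, k0, k1]
    simp
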